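/- Let $p$ be a prime, let $n\ge 0$ be an integer, and equip $\mathbb{Q}_p^n$ with the maximum norm $\|x\|_p=\max_i|x_i|_p$. Let $\mathcal{S}_n=\{x\in\mathbb{Q}_p^n : \|x\|_p=1\}$ (so $\mathcal{S}_0=\emptyset$). The group $GL(n,\mathbb{Q}_p)$ acts on $\mathcal{S}_n$ by the homeomorphisms $\overline{T}(x)=\|T(x)\|_p\,T(x)$, where the scalar $\|T(x)\|_p$, an integral power of $p$, is regarded as an element of $\mathbb{Q}_p$. A semigroup $\mathfrak{S}\subset GL(n,\mathbb{Q}_p)$ (a nonempty subset closed under multiplication) is said to act distally on $\mathcal{S}_n$ if for all $x\neq y$ in $\mathcal{S}_n$ the closure of $\{(\overline{T}(x),\overline{T}(y)) : T\in\mathfrak{S}\}$ in $\mathcal{S}_n\times\mathcal{S}_n$ does not meet the diagonal. Then: (1) A semigroup $\mathfrak{S}\subset SL(n,\mathbb{Q}_p)$ acts distally on $\mathcal{S}_n$ if and only if its closure in $SL(n,\mathbb{Q}_p)$ is a compact group. (2) If $\mathfrak{S}\subset GL(n,\mathbb{Q}_p)$ is a semigroup such that $|\det T|_p=1$ for all $T\in\mathfrak{S}$,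 then $\mathfrak{S}$ acts distally on $\mathcal{S}_n$ if and only if its closure in $GL(n,\mathbb{Q}_p)$ is a compact group. -/

import Mathlib

open Matrix

/-- A set `S` of self-homeomorphisms of a topological space `X` (in the applications a semigroup)
acts distally on `X`: for any two distinct points `x`, `y`, the closure in `X × X` of
`{(T x, T y) | T ∈ S}` does not meet the diagonal. -/
def ActsDistally {X : Type*} [TopologicalSpace X] (S : Set (X ≃ₜ X)) : Prop :=
  ∀ x y : X, x ≠ y → Disjoint (closure {q : X × X | ∃ T ∈ S, q = (T x, T y)}) (Set.diagonal X)

/-- A subset of a topological group is a compact group: it is compact and it is (the carrier of) a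
subgroup. -/
def IsCompactGroup {G : Type*} [Group G] [TopologicalSpace G] (A : Set G) : Prop :=
  IsCompact A ∧ ∃ H : Subgroup G, (H : Set G) = A

namespace PadicSphere

variable (p : ℕ) [Fact p.Prime] (n : ℕ)

/-- The `p`-adic unit sphere `{x ∈ ℚ_p ^ n | ‖x‖ = 1}`, for the maximum norm (which is Mathlib's
norm on `Fin n → ℚ_[p]`). -/
abbrev Sphere : Type := Metric.sphere (0 : Fin n → ℚ_[p]) 1

variable {p n}

/-- The norm `‖x‖` of a nonzero vector `x`, a power `p ^ k` of `p` with `k ∈ ℤ`, regarded as an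
element of `ℚ_p` (see `norm_eq_zpow_log`). The value at `x = 0` is never used. -/
noncomputable def padicNormVal (x : Fin n → ℚ_[p]) : ℚ_[p] := (p : ℚ_[p]) ^ Int.log p ‖x‖

theorem padicNormVal_ne_zero (x : Fin n → ℚ_[p]) : padicNormVal x ≠ 0 :=
  zpow_ne_zero _ (by exact_mod_cast (Fact.out : p.Prime).ne_zero)

theorem exists_norm_eq_zpow {x : Fin n → ℚ_[p]} (hx : x ≠ 0) :
    ∃ k : ℤ, ‖x‖ = (p : ℝ) ^ k := by
  have hn : Nonempty (Fin n) := by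
    by_contra h
    rw [not_nonempty_iff] at h
    exact hx (Subsingleton.elim _ _)
  obtain ⟨i, -, hi⟩ := Finset.exists_mem_eq_sup' (Finset.univ_nonempty) (fun i => ‖x i‖₊)
  have h : ‖x‖ = ‖x i‖ := by
    rw [Pi.norm_def, ← Finset.sup'_eq_sup Finset.univ_nonempty, hi]
    rfl
  have hxi : x i ≠ 0 := by
    intro h0
    rw [h0, norm_zero, norm_eq_zero] at h
    exact hx h
  exact ⟨_, h.trans (Padic.norm_eq_zpow_neg_valuation hxi)⟩

theorem norm_eq_zpow_log {x : Fin n → ℚ_[p]} (hx : x ≠ 0) :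
    ‖x‖ = (p : ℝ) ^ Int.log p ‖x‖ := by
  obtain ⟨k, hk⟩ := exists_norm_eq_zpow hx
  rw [hk, Int.log_zpow (Fact.out : p.Prime).one_lt]

theorem norm_padicNormVal {x : Fin n → ℚ_[p]} (hx : x ≠ 0) : ‖padicNormVal x‖ = ‖x‖⁻¹ := by
  rw [padicNormVal, Padic.norm_p_zpow, _root_.zpow_neg, ← norm_eq_zpow_log hx]

theorem padicNormVal_smul (k : ℤ) {x : Fin n → ℚ_[p]} (hx : x ≠ 0) :
    padicNormVal ((p : ℚ_[p]) ^ k • x) = (p : ℚ_[p]) ^ (-k) * padicNormVal x := by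
  have hp := (Fact.out : p.Prime)
  obtain ⟨m, hm⟩ := exists_norm_eq_zpow hx
  have h1 : ‖(p : ℚ_[p]) ^ k • x‖ = (p : ℝ) ^ (-k + m) := by
    rw [norm_smul, Padic.norm_p_zpow, hm, zpow_add₀ (by exact_mod_cast hp.ne_zero)]
  rw [padicNormVal, padicNormVal, h1, hm, Int.log_zpow hp.one_lt, Int.log_zpow hp.one_lt,
    zpow_add₀ (by exact_mod_cast hp.ne_zero)]

theorem continuousAt_padicNormVal {x : Fin n → ℚ_[p]} (hx : x ≠ 0) :
    ContinuousAt (padicNormVal : (Fin n → ℚ_[p]) → ℚ_[p]) x := by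
  have h : ∀ᶠ y in nhds x, ‖y‖ = ‖x‖ := by
    filter_upwards [Metric.ball_mem_nhds x (norm_pos_iff.mpr hx)] with y hy
    rw [mem_ball_iff_norm] at hy
    have h1 := IsUltrametricDist.norm_add_eq_max_of_norm_ne_norm hy.ne
    rw [sub_add_cancel, max_eq_right hy.le] at h1
    exact h1
  refine (continuousAt_const (y := padicNormVal x)).congr ?_
  filter_upwards [h] with y hy
  rw [padicNormVal, padicNormVal, hy]

theorem ne_zero_of_sphere (x : Sphere p n) : (x : Fin n → ℚ_[p]) ≠ 0 :=
  ne_zero_of_mem_unit_sphere x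

theorem mulVec_ne_zero (T : GL (Fin n) ℚ_[p]) {x : Fin n → ℚ_[p]} (hx : x ≠ 0) :
    (T : Matrix (Fin n) (Fin n) ℚ_[p]) *ᵥ x ≠ 0 := by
  intro h
  apply hx
  have h1 : ((T⁻¹ : GL (Fin n) ℚ_[p]) : Matrix (Fin n) (Fin n) ℚ_[p]) *ᵥ
      ((T : Matrix (Fin n) (Fin n) ℚ_[p]) *ᵥ x) = x := by
    rw [mulVec_mulVec, Units.inv_mul, one_mulVec]
  rw [← h1, h, mulVec_zero]

/-- The map `x ↦ ‖T x‖ • T x` of the `p`-adic unit sphere induced by `T ∈ GL(n, ℚ_p)`; here the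
scalar `‖T x‖`, a power of `p`, is taken in `ℚ_p`. -/
noncomputable def sphereMap (T : GL (Fin n) ℚ_[p]) (x : Sphere p n) : Sphere p n :=
  ⟨padicNormVal ((T : Matrix (Fin n) (Fin n) ℚ_[p]) *ᵥ x) •
      ((T : Matrix (Fin n) (Fin n) ℚ_[p]) *ᵥ x), by
    have h := mulVec_ne_zero T (ne_zero_of_sphere x)
    rw [mem_sphere_zero_iff_norm, norm_smul, norm_padicNormVal h,
      inv_mul_cancel₀ (norm_ne_zero_iff.mpr h)]⟩

theorem sphereMap_one (x : Sphere p n) : sphereMap 1 x = x := by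
  apply Subtype.ext
  have hx : ‖(x : Fin n → ℚ_[p])‖ = 1 := norm_eq_of_mem_sphere x
  simp [sphereMap, padicNormVal, hx]

theorem sphereMap_mul (T U : GL (Fin n) ℚ_[p]) (x : Sphere p n) :
    sphereMap (T * U) x = sphereMap T (sphereMap U x) := by
  apply Subtype.ext
  have hp : (p : ℚ_[p]) ≠ 0 := by exact_mod_cast (Fact.out : p.Prime).ne_zero
  have h := mulVec_ne_zero T (mulVec_ne_zero U (ne_zero_of_sphere x))
  simp only [sphereMap, Units.val_mul, mulVec_smul]
  rw [← mulVec_mulVec]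
  conv_rhs => rw [show padicNormVal ((U : Matrix (Fin n) (Fin n) ℚ_[p]) *ᵥ (x : Fin n → ℚ_[p])) =
    (p : ℚ_[p]) ^ Int.log p ‖(U : Matrix (Fin n) (Fin n) ℚ_[p]) *ᵥ (x : Fin n → ℚ_[p])‖ from rfl,
    padicNormVal_smul _ h, smul_smul, mul_right_comm, _root_.zpow_neg, inv_mul_cancel₀ (zpow_ne_zero _ hp),
    one_mul]

theorem continuous_sphereMap (T : GL (Fin n) ℚ_[p]) : Continuous (sphereMap T) := by
  refine Continuous.subtype_mk ?_ _
  have h : Continuous fun x : Sphere p n =>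
      (T : Matrix (Fin n) (Fin n) ℚ_[p]) *ᵥ (x : Fin n → ℚ_[p]) :=
    continuous_const.matrix_mulVec continuous_subtype_val
  suffices hc : Continuous fun x : Sphere p n =>
      padicNormVal ((T : Matrix (Fin n) (Fin n) ℚ_[p]) *ᵥ (x : Fin n → ℚ_[p])) from hc.smul h
  rw [continuous_iff_continuousAt]
  intro x
  exact ContinuousAt.comp
    (f := fun x : Sphere p n => (T : Matrix (Fin n) (Fin n) ℚ_[p]) *ᵥ (x : Fin n → ℚ_[p]))
    (continuousAt_padicNormVal (mulVec_ne_zero T (ne_zero_of_sphere x))) h.continuousAt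

variable (p n)

/-- The action of `GL(n, ℚ_p)` on the `p`-adic unit sphere by homeomorphisms
`x ↦ ‖T x‖ • T x`. -/
noncomputable def glAction : GL (Fin n) ℚ_[p] →* (Sphere p n ≃ₜ Sphere p n) where
  toFun T :=
    { toFun := sphereMap T
      invFun := sphereMap T⁻¹
      left_inv := fun x => by rw [← sphereMap_mul, inv_mul_cancel, sphereMap_one]
      right_inv := fun x => by rw [← sphereMap_mul, mul_inv_cancel, sphereMap_one]
      continuous_toFun := continuous_sphereMap T
      continuous_invFun := continuous_sphereMap T⁻¹ }
  map_one' := Homeomorph.ext sphereMap_one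
  map_mul' T U := Homeomorph.ext (sphereMap_mul T U)

/-- The restriction of the action to `SL(n, ℚ_p)`. -/
noncomputable def slAction : SpecialLinearGroup (Fin n) ℚ_[p] →* (Sphere p n ≃ₜ Sphere p n) :=
  (glAction p n).comp SpecialLinearGroup.toGL

end PadicSphere

/-!
The content is that a set `S` of matrices whose determinants have norm `1` is bounded as soon as it
acts distally on the sphere. Were it unbounded, suitable multiples `p ^ k i • T i` of elements of
`S` would have norms in a fixed shell and converge to a matrix `A`, nonzero but singular, because
the scalars tend to `0` and `n ≥ 1`. Rescaling by powers of `p` does not change the maps of the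
sphere, so these converge to `x ↦ ‖A x‖ • A x` off `ker A`
(`PadicSphere.tendsto_sphereMap`). For `x` on the sphere with `A x ≠ 0`, and `v ≠ 0` in `ker A`
with `‖v‖ < 1`, the vector `x + v` is again on the sphere by the ultrametric inequality, and the
images of `x` and `x + v` approach the same point, which contradicts distality
(`PadicSphere.not_actsDistally_of_tendsto`).

Boundedness of `S` bounds the inverses as well, by Cramer's rule, so the closure of `S` is compact,
and a compact subsemigroup of a Hausdorff group is a subgroup (`isCompactGroup_of_isCompact`).
Conversely, the orbit of a pair of distinct points under a compact set of matrices is compact, hence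
closed, and misses the diagonal since each matrix acts injectively.

Boundedness uses the semigroup law nowhere, so the equivalence can be proved at once for any closed
embedding of a topological group into `GL(n, ℚ_p)`, and then be applied to `SL(n, ℚ_p)` and to
`GL(n, ℚ_p)` itself.
-/

open Filter Topology

/-! ### Compact subsemigroups of topological groups -/

/-- Both the unit and the inverses come from idempotents: the only idempotent of a group is `1`,
and the compact semigroups `A` and `x * A`, for `x ∈ A`, contain one by the Ellis–Numakura lemma. -/
theorem isCompactGroup_of_isCompact {G : Type*} [Group G] [TopologicalSpace G]
    [IsTopologicalGroup G] [T2Space G] {A : Subsemigroup G} (hne : (A : Set G).Nonempty)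
    (hA : IsCompact (A : Set G)) : IsCompactGroup (A : Set G) := by
  have one_mem_of : ∀ s : Set G, s.Nonempty → IsCompact s →
      (∀ᵉ (x ∈ s) (y ∈ s), x * y ∈ s) → (1 : G) ∈ s := by
    intro s hs hc hmul
    obtain ⟨m, hm, hmm⟩ := exists_idempotent_in_compact_subsemigroup
      (fun r : G => continuous_mul_const r) s hs hc hmul
    rwa [mul_eq_left.mp hmm] at hm
  refine ⟨hA, { A with one_mem' := one_mem_of _ hne hA fun x hx y hy => A.mul_mem hx hy,
                       inv_mem' := ?_ }, rfl⟩
  intro x hx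
  obtain ⟨y, hy, hxy⟩ := one_mem_of ((x * ·) '' (A : Set G)) (hne.image _)
    (hA.image (continuous_const_mul x)) (by
      rintro _ ⟨a, ha, rfl⟩ _ ⟨b, hb, rfl⟩
      exact ⟨a * (x * b), A.mul_mem ha (A.mul_mem hx hb), by simp only [mul_assoc]⟩)
  rwa [inv_eq_of_mul_eq_one_right hxy]

namespace PadicSphere

variable {p : ℕ} [Fact p.Prime] {n : ℕ}

/-! ### Compactness implies distality -/

theorem continuous_sphereMap_apply (x : Sphere p n) :
    Continuous fun T : GL (Fin n) ℚ_[p] => sphereMap T x := by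
  refine Continuous.subtype_mk ?_ _
  have h : Continuous fun T : GL (Fin n) ℚ_[p] =>
      (T : Matrix (Fin n) (Fin n) ℚ_[p]) *ᵥ (x : Fin n → ℚ_[p]) :=
    Units.continuous_val.matrix_mulVec continuous_const
  suffices hc : Continuous fun T : GL (Fin n) ℚ_[p] =>
      padicNormVal ((T : Matrix (Fin n) (Fin n) ℚ_[p]) *ᵥ (x : Fin n → ℚ_[p])) from hc.smul h
  rw [continuous_iff_continuousAt]
  intro T
  exact ContinuousAt.comp
    (f := fun T : GL (Fin n) ℚ_[p] =>
      (T : Matrix (Fin n) (Fin n) ℚ_[p]) *ᵥ (x : Fin n → ℚ_[p]))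
    (continuousAt_padicNormVal (mulVec_ne_zero T (ne_zero_of_sphere x))) h.continuousAt

theorem actsDistally_of_subset_isCompact {S K : Set (GL (Fin n) ℚ_[p])} (hSK : S ⊆ K)
    (hK : IsCompact K) : ActsDistally (glAction p n '' S) := by
  intro x y hxy
  have hc : IsCompact ((fun T => (sphereMap T x, sphereMap T y)) '' K) :=
    hK.image ((continuous_sphereMap_apply x).prodMk (continuous_sphereMap_apply y))
  have hsub : closure {q : Sphere p n × Sphere p n |
      ∃ T ∈ glAction p n '' S, q = (T x, T y)} ⊆
      (fun T => (sphereMap T x, sphereMap T y)) '' K := by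
    refine closure_minimal ?_ hc.isClosed
    rintro _ ⟨_, ⟨T, hT, rfl⟩, rfl⟩
    exact ⟨T, hSK hT, rfl⟩
  refine Set.disjoint_left.mpr fun q hq hdiag => ?_
  obtain ⟨T, -, rfl⟩ := hsub hq
  exact hxy ((glAction p n T).injective hdiag)

/-! ### Distality implies boundedness -/

theorem norm_padicNormVal_smul {x : Fin n → ℚ_[p]} (hx : x ≠ 0) : ‖padicNormVal x • x‖ = 1 := by
  rw [norm_smul, norm_padicNormVal hx, inv_mul_cancel₀ (norm_ne_zero_iff.mpr hx)]

/-- The map of the sphere given by `T` depends only on the class of `T` modulo powers of `p`, so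
it converges pointwise, off the kernel of `A`, when suitable multiples of the `T i` tend to a
possibly singular matrix `A`. -/
theorem tendsto_sphereMap {T : ℕ → GL (Fin n) ℚ_[p]} {k : ℕ → ℤ}
    {A : Matrix (Fin n) (Fin n) ℚ_[p]}
    (hT : Tendsto (fun i => (p : ℚ_[p]) ^ k i • (T i : Matrix (Fin n) (Fin n) ℚ_[p])) atTop (𝓝 A))
    (x : Sphere p n) (hx : A *ᵥ (x : Fin n → ℚ_[p]) ≠ 0) :
    Tendsto (fun i => sphereMap (T i) x) atTop
      (𝓝 ⟨padicNormVal (A *ᵥ (x : Fin n → ℚ_[p])) • (A *ᵥ (x : Fin n → ℚ_[p])),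
        mem_sphere_zero_iff_norm.mpr (norm_padicNormVal_smul hx)⟩) := by
  rw [tendsto_subtype_rng]
  have hp : (p : ℚ_[p]) ≠ 0 := by exact_mod_cast (Fact.out : p.Prime).ne_zero
  have hc : Continuous fun B : Matrix (Fin n) (Fin n) ℚ_[p] => B *ᵥ (x : Fin n → ℚ_[p]) :=
    continuous_id.matrix_mulVec continuous_const
  have h1 := (hc.tendsto A).comp hT
  refine (((continuousAt_padicNormVal hx).tendsto.comp h1).smul h1).congr fun i => ?_
  simp only [Function.comp_apply, smul_mulVec, sphereMap]
  rw [padicNormVal_smul _ (mulVec_ne_zero (T i) (ne_zero_of_sphere x)), smul_smul,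
    mul_right_comm, _root_.zpow_neg, inv_mul_cancel₀ (zpow_ne_zero _ hp), one_mul]

/-- If `A` is nonzero and singular, a vector `x` of the sphere outside `ker A` and its translate by
a short vector of `ker A` are driven to the same point. -/
theorem not_actsDistally_of_tendsto {S : Set (GL (Fin n) ℚ_[p])} {T : ℕ → GL (Fin n) ℚ_[p]}
    (hTS : ∀ i, T i ∈ S) {k : ℕ → ℤ} {A : Matrix (Fin n) (Fin n) ℚ_[p]}
    (hT : Tendsto (fun i => (p : ℚ_[p]) ^ k i • (T i : Matrix (Fin n) (Fin n) ℚ_[p])) atTop (𝓝 A))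
    (hA : A ≠ 0) (hdet : A.det = 0) : ¬ ActsDistally (glAction p n '' S) := by
  intro hd
  have hp : (p : ℚ_[p]) ≠ 0 := by exact_mod_cast (Fact.out : p.Prime).ne_zero
  obtain ⟨v, hv, hAv⟩ := exists_mulVec_eq_zero_iff.mpr hdet
  obtain ⟨x, hx⟩ : ∃ x, A *ᵥ x ≠ 0 := by
    by_contra! h
    exact hA (ext_of_mulVec_single fun i => by rw [h, zero_mulVec])
  have hx0 : x ≠ 0 := by rintro rfl; exact hx (mulVec_zero A)
  set x' : Fin n → ℚ_[p] := padicNormVal x • x with hx'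
  set v' : Fin n → ℚ_[p] := (p : ℚ_[p]) • padicNormVal v • v with hv'
  have hx1 : ‖x'‖ = 1 := norm_padicNormVal_smul hx0
  have hv1 : ‖v'‖ < 1 := by
    rw [hv', norm_smul, norm_padicNormVal_smul hv, mul_one]
    exact Padic.norm_p_lt_one
  have hv0 : v' ≠ 0 := smul_ne_zero hp (smul_ne_zero (padicNormVal_ne_zero v) hv)
  have hxv1 : ‖x' + v'‖ = 1 := by
    have h := IsUltrametricDist.norm_add_eq_max_of_norm_ne_norm (x := x') (y := v')
      (by rw [hx1]; exact hv1.ne')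
    rw [h, hx1, max_eq_left hv1.le]
  have hAx' : A *ᵥ x' ≠ 0 := by
    rw [hx', mulVec_smul]; exact smul_ne_zero (padicNormVal_ne_zero x) hx
  have hAxv : A *ᵥ (x' + v') = A *ᵥ x' := by
    rw [mulVec_add, hv', mulVec_smul A (p : ℚ_[p]), mulVec_smul A (padicNormVal v), hAv, smul_zero,
      smul_zero, add_zero]
  let a : Sphere p n := ⟨x', mem_sphere_zero_iff_norm.mpr hx1⟩
  let b : Sphere p n := ⟨x' + v', mem_sphere_zero_iff_norm.mpr hxv1⟩
  have hab : a ≠ b := fun h => hv0 (left_eq_add.mp (congrArg Subtype.val h))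
  have ha := tendsto_sphereMap hT a hAx'
  have hb := tendsto_sphereMap hT b (by change A *ᵥ (x' + v') ≠ 0; rwa [hAxv])
  refine Set.disjoint_left.mp (hd a b hab)
    (mem_closure_of_tendsto (ha.prodMk_nhds hb) (Eventually.of_forall fun i =>
      ⟨_, ⟨T i, hTS i, rfl⟩, rfl⟩)) (Subtype.ext ?_)
  change padicNormVal (A *ᵥ x') • (A *ᵥ x') = padicNormVal (A *ᵥ (x' + v')) • (A *ᵥ (x' + v'))
  rw [hAxv]

open scoped Matrix.Norms.Elementwise in
theorem exists_isCompact_of_actsDistally {S : Set (GL (Fin n) ℚ_[p])}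
    (hdet : ∀ T ∈ S, ‖(T : Matrix (Fin n) (Fin n) ℚ_[p]).det‖ = 1)
    (hd : ActsDistally (glAction p n '' S)) :
    ∃ K : Set (Matrix (Fin n) (Fin n) ℚ_[p]), IsCompact K ∧
      ∀ T ∈ S, (T : Matrix (Fin n) (Fin n) ℚ_[p]) ∈ K := by
  have : ProperSpace (Matrix (Fin n) (Fin n) ℚ_[p]) :=
    inferInstanceAs (ProperSpace (Fin n → Fin n → ℚ_[p]))
  by_contra! h
  have hunb : ∀ i : ℕ, ∃ T ∈ S, (i : ℝ) < ‖(T : Matrix (Fin n) (Fin n) ℚ_[p])‖ := by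
    intro i
    obtain ⟨T, hT, hi⟩ := h _ (isCompact_closedBall 0 (i : ℝ))
    exact ⟨T, hT, by simpa using hi⟩
  choose T hTS hT using hunb
  have hT0 : ∀ i, (T i : Matrix (Fin n) (Fin n) ℚ_[p]) ≠ 0 := fun i =>
    norm_pos_iff.mp ((Nat.cast_nonneg i).trans_lt (hT i))
  have hp1 : (1 : ℝ) < p := by exact_mod_cast (Fact.out : p.Prime).one_lt
  have hc : 1 < ‖(p : ℚ_[p])⁻¹‖ := by simpa using hp1
  choose m hm0 hm1 hm2 hm3 using fun i => rescale_to_shell_zpow hc one_pos (hT0 i)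
  have hcT : ∀ i, ‖((p : ℚ_[p])⁻¹ ^ m i)‖ * i ≤ 1 := by
    intro i
    refine le_trans ?_ ((norm_smul _ _).symm.trans_lt (hm1 i)).le
    gcongr
    exact (hT i).le
  obtain ⟨A, -, φ, hφ, hA⟩ := tendsto_subseq_of_bounded Metric.isBounded_closedBall
    (fun i => mem_closedBall_zero_iff.mpr (hm1 i).le)
  have hA0 : A ≠ 0 := by
    refine norm_pos_iff.mp (lt_of_lt_of_le ?_
      (ge_of_tendsto' hA.norm fun i => hm2 (φ i)))
    positivity
  have hn : Fintype.card (Fin n) ≠ 0 := by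
    intro h0
    have : IsEmpty (Fin n) := Fintype.card_eq_zero_iff.mp h0
    exact hA0 (Subsingleton.elim _ _)
  -- The scalars tend to zero because the norms of the matrices are unbounded, while
  -- the determinants of the matrices are units.
  have hscal : Tendsto (fun i => ‖((p : ℚ_[p])⁻¹ ^ m i)‖) atTop (𝓝 0) := by
    refine squeeze_zero' (g := fun i : ℕ => (1 : ℝ) / i)
      (Eventually.of_forall fun i => norm_nonneg _) ?_ tendsto_one_div_atTop_nhds_zero_nat
    filter_upwards [eventually_gt_atTop 0] with i hi
    rw [le_div_iff₀ (by exact_mod_cast hi)]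
    exact hcT i
  have hdetA : A.det = 0 := by
    have hcont : Continuous fun B : Matrix (Fin n) (Fin n) ℚ_[p] => ‖B.det‖ :=
      continuous_id.matrix_det.norm
    have h1 := (hcont.tendsto A).comp hA
    have h2 := (hscal.comp hφ.tendsto_atTop).pow (Fintype.card (Fin n))
    rw [zero_pow hn] at h2
    refine norm_eq_zero.mp (tendsto_nhds_unique h1 (h2.congr fun i => ?_))
    simp only [Function.comp_apply]
    rw [det_smul, norm_mul, norm_pow, hdet _ (hTS _), mul_one]
  refine not_actsDistally_of_tendsto (T := fun i => T (φ i)) (k := fun i => - m (φ i))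
    (fun i => hTS _) (hA.congr fun i => ?_) hA0 hdetA hd
  simp only [Function.comp_apply, _root_.inv_zpow, _root_.zpow_neg]

/-- By Cramer's rule the inverse of `T` is the adjugate divided by the determinant, hence
remains in a compact set along with `T`, as the determinant is a unit. -/
theorem isCompact_closure_of_actsDistally {S : Set (GL (Fin n) ℚ_[p])}
    (hdet : ∀ T ∈ S, ‖(T : Matrix (Fin n) (Fin n) ℚ_[p]).det‖ = 1)
    (hd : ActsDistally (glAction p n '' S)) : IsCompact (closure S) := by
  obtain ⟨K, hK, hSK⟩ := exists_isCompact_of_actsDistally hdet hd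
  let L : Set (Matrix (Fin n) (Fin n) ℚ_[p]) :=
    (fun q : ℚ_[p] × Matrix (Fin n) (Fin n) ℚ_[p] => q.1 • q.2.adjugate) ''
      (Metric.sphere 0 1 ×ˢ K)
  have hL : IsCompact L := ((isCompact_sphere 0 1).prod hK).image
    (continuous_fst.smul continuous_snd.matrix_adjugate)
  have hKL := Units.isClosedEmbedding_embedProduct.isCompact_preimage
    (hK.prod (MulOpposite.opHomeomorph.symm.isCompact_preimage.mpr hL))
  refine hKL.closure_of_subset fun T hT => ⟨hSK T hT, ?_⟩
  refine ⟨((T : Matrix (Fin n) (Fin n) ℚ_[p]).det⁻¹, T), ⟨?_, hSK T hT⟩, ?_⟩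
  · rw [mem_sphere_zero_iff_norm, norm_inv, hdet T hT, inv_one]
  · simp [coe_units_inv, inv_def]

/-! ### The equivalence for a closed group of matrices -/

/-- Both the special and the general linear group are closed subgroups of `GL(n, ℚ_p)`, and the
equivalence is the same for each of them. -/
theorem actsDistally_iff_isCompactGroup {G : Type*} [Group G] [TopologicalSpace G]
    [IsTopologicalGroup G] [T2Space G] {φ : G →* GL (Fin n) ℚ_[p]} (hφ : IsClosedEmbedding φ)
    {S : Subsemigroup G} (hne : (S : Set G).Nonempty)
    (hdet : ∀ T ∈ S, ‖(φ T : Matrix (Fin n) (Fin n) ℚ_[p]).det‖ = 1) :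
    ActsDistally (((glAction p n).comp φ) '' (S : Set G)) ↔
      IsCompactGroup (closure (S : Set G)) := by
  rw [MonoidHom.coe_comp, Set.image_comp]
  constructor
  · intro h
    have hc := isCompact_closure_of_actsDistally (by rintro _ ⟨T, hT, rfl⟩; exact hdet T hT) h
    have hc' : IsCompact (closure (S : Set G)) :=
      (hφ.isCompact_preimage hc).closure_of_subset fun T hT =>
        subset_closure (Set.mem_image_of_mem φ hT)
    exact isCompactGroup_of_isCompact (A := S.topologicalClosure) hne.closure hc'
  · rintro ⟨hc, -⟩
    exact actsDistally_of_subset_isCompact (Set.image_mono subset_closure)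
      (hc.image hφ.continuous)

end PadicSphere

theorem corollary2p5 (p : ℕ) [Fact p.Prime] (n : ℕ) :
    (∀ S : Subsemigroup (Matrix.SpecialLinearGroup (Fin n) ℚ_[p]),
      (S : Set (Matrix.SpecialLinearGroup (Fin n) ℚ_[p])).Nonempty →
      (ActsDistally
          (PadicSphere.slAction p n '' (S : Set (Matrix.SpecialLinearGroup (Fin n) ℚ_[p]))) ↔
        IsCompactGroup (closure (S : Set (Matrix.SpecialLinearGroup (Fin n) ℚ_[p]))))) ∧
    (∀ S : Subsemigroup (Matrix.GeneralLinearGroup (Fin n) ℚ_[p]),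
      (S : Set (Matrix.GeneralLinearGroup (Fin n) ℚ_[p])).Nonempty →
      (∀ T ∈ S, ‖(T : Matrix (Fin n) (Fin n) ℚ_[p]).det‖ = 1) →
      (ActsDistally
          (PadicSphere.glAction p n '' (S : Set (Matrix.GeneralLinearGroup (Fin n) ℚ_[p]))) ↔
        IsCompactGroup (closure (S : Set (Matrix.GeneralLinearGroup (Fin n) ℚ_[p]))))) := by
  have : T2Space (SpecialLinearGroup (Fin n) ℚ_[p]) :=
    SpecialLinearGroup.isEmbedding_toGL.t2Space
  exact ⟨fun S hne => PadicSphere.actsDistally_iff_isCompactGroup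
      SpecialLinearGroup.isClosedEmbedding_toGL hne fun T _ => by simp,
    fun S hne hdet => PadicSphere.actsDistally_iff_isCompactGroup (φ := MonoidHom.id _)
      IsClosedEmbedding.id hne hdet⟩
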